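/- Let $d\ge 0$ be an integer and let $A:\mathbb{R}^d\to\mathbb{R}^d$ be an expansive dilation, i.e. a linear map with $A(\mathbb{Z}^d)\subseteq\mathbb{Z}^d$ all of whose complex eigenvalues have modulus strictly greater than $1$. Let $A^*$ be its adjoint, and let $\mathcal{D}_A f(x)=|\det A|^{1/2}f(Ax)$, a unitary operator on $L^2(\mathbb{R}^d)$. Write $\widehat f(\xi)=\int f(x)e^{-2\pi i x\cdot\xi}\,dx$ for the Fourier transform (extended to $L^2$), $\operatorname{Supp} h=\{\xi: h(\xi)\ne 0\}$, and, for $G\subseteq\mathbb{R}^d$, $H^2_G=\{f\in L^2(\mathbb{R}^d):\operatorname{Supp}\widehat f\subseteq G\}$. Equalities and inclusions of subsets of $\mathbb{R}^d$ are understood up to Lebesgue null sets. Let $V\subseteq L^2(\mathbb{R}^d)$ be a shift-invariant subspace (closed, with $f(\cdot-k)\in V$ for all $f\in V$, $k\in\mathbb{Z}^d$) which is $A$-refinable, i.e. $V\subseteq\mathcal{D}_A V$. Let $\mathcal{G}\subseteq V$ generate $V$, i.e. the linear span of $\{\phi(\cdot-k):\phi\in\mathcal{G},\,k\in\mathbb{Z}^d\}$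 is dense in $V$. A spectral function of $V$ is a function equal almost everywhere to $\sigma_V(\xi)=\sum_{\alpha\in I}|\widehat{\phi^\alpha}(\xi)|^2$, where $\{\phi^\alpha\}_{\alpha\in I}\subseteq V$ is a countable tight frame generator of $V$, i.e. $\sum_{\alpha\in I}\sum_{k\in\mathbb{Z}^d}|\langle f,\phi^\alpha(\cdot-k)\rangle|^2=\|f\|^2$ for all $f\in V$. Then $V$ has a spectral function, and for every spectral function $\sigma_V$ of $V$, if $$G:=\bigcup_{j\in\mathbb{Z}}A^{*j}(\operatorname{Supp}(\sigma_V)),$$ then $$\overline{\bigcup_{j\in\mathbb{Z}}\mathcal{D}_A^jV}=H^2_G\qquad\text{and}\qquad G=\bigcup_{\phi\in\mathcal{G}}\bigcup_{j\in\mathbb{Z}}A^{*j}(\operatorname{Supp}(\widehat\phi)).$$ Here, if $\mathcal{G}$ is uncountable, the union over $\phi\in\mathcal{G}$ is the essential union, i.e. the least set, up to null sets, that contains each $\bigcup_{j\in\mathbb{Z}}A^{*j}(\operatorname{Supp}(\widehat\phi))$ up to a null set; for countable $\mathcal{G}$ the equality holds both for the ordinary union and for the essential union. -/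

import Mathlib

open MeasureTheory FourierTransform
open scoped ENNReal

noncomputable section

namespace ShiftInv

/-- `ℝ^d` with its Euclidean structure. -/
abbrev E (d : ℕ) : Type := EuclideanSpace ℝ (Fin d)

/-- The complex Hilbert space `L²(ℝ^d)`. -/
abbrev L2 (d : ℕ) : Type := Lp (α := E d) ℂ 2 (volume : Measure (E d))

/-- The vector of `ℤ^d`, seen in `ℝ^d`. -/
def intVec {d : ℕ} (k : Fin d → ℤ) : E d := WithLp.toLp 2 (fun i => (k i : ℝ))

/-- The shift `f ↦ f(· - k)` on `L²(ℝ^d)`, for `k ∈ ℤ^d`. -/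
def shift {d : ℕ} (k : Fin d → ℤ) : L2 d →ₗᵢ[ℂ] L2 d :=
  Lp.compMeasurePreservingₗᵢ ℂ (fun x : E d => x - intVec k)
    (measurePreserving_sub_right volume (intVec k))

/-- A shift-invariant space: a closed subspace of `L²(ℝ^d)` stable under integer shifts. -/
structure IsShiftInvariant {d : ℕ} (V : Submodule ℂ (L2 d)) : Prop where
  isClosed : IsClosed (V : Set (L2 d))
  shift_mem : ∀ f ∈ V, ∀ k : Fin d → ℤ, shift k f ∈ V

/-- Expansive dilation: `A(ℤ^d) ⊆ ℤ^d`, and every complex eigenvalue of `A` (that is, every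
eigenvalue of its complexification) has modulus `> 1`. -/
structure IsExpansiveDilation {d : ℕ} (A : E d →ₗ[ℝ] E d) : Prop where
  map_int : ∀ k : Fin d → ℤ, ∃ l : Fin d → ℤ, A (intVec k) = intVec l
  one_lt_norm : ∀ z : ℂ, Module.End.HasEigenvalue (A.baseChange ℂ) z → 1 < ‖z‖

theorem IsExpansiveDilation.det_ne_zero {d : ℕ} {A : E d →ₗ[ℝ] E d}
    (hA : IsExpansiveDilation A) : LinearMap.det A ≠ 0 := by
  intro h
  have h0 : LinearMap.det (A.baseChange ℂ) = 0 := by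
    rw [LinearMap.det_baseChange, h, map_zero]
  have h1 : Module.End.HasEigenvalue (A.baseChange ℂ) 0 := by
    rw [Module.End.hasEigenvalue_iff, Module.End.eigenspace_zero]
    exact (LinearMap.bot_lt_ker_of_det_eq_zero h0).ne'
  have h2 := hA.one_lt_norm 0 h1
  norm_num at h2

theorem IsExpansiveDilation.det_adjoint_ne_zero {d : ℕ} {A : E d →ₗ[ℝ] E d}
    (hA : IsExpansiveDilation A) : LinearMap.det (LinearMap.adjoint A) ≠ 0 := by
  intro h
  obtain ⟨x, hx, hx0⟩ := Submodule.exists_mem_ne_zero_of_ne_bot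
    (LinearMap.bot_lt_ker_of_det_eq_zero h).ne'
  obtain ⟨y, rfl⟩ := (LinearMap.equivOfDetNeZero A hA.det_ne_zero).surjective x
  apply hx0
  rw [← inner_self_eq_zero (𝕜 := ℝ)]
  change inner ℝ (A y) (A y) = 0
  rw [← LinearMap.adjoint_inner_right]
  change inner ℝ y (LinearMap.adjoint A (LinearMap.equivOfDetNeZero A hA.det_ne_zero y)) = 0
  rw [LinearMap.mem_ker.1 hx, inner_zero_right]

/-- An expansive dilation as an invertible linear map. -/
def IsExpansiveDilation.equiv {d : ℕ} {A : E d →ₗ[ℝ] E d}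
    (hA : IsExpansiveDilation A) : E d ≃ₗ[ℝ] E d :=
  LinearMap.equivOfDetNeZero A hA.det_ne_zero

@[simp]
theorem IsExpansiveDilation.equiv_apply {d : ℕ} {A : E d →ₗ[ℝ] E d}
    (hA : IsExpansiveDilation A) (x : E d) : hA.equiv x = A x := rfl

/-- The adjoint `A^*` of an expansive dilation as an invertible linear map. -/
def IsExpansiveDilation.adjointEquiv {d : ℕ} {A : E d →ₗ[ℝ] E d}
    (hA : IsExpansiveDilation A) : E d ≃ₗ[ℝ] E d :=
  LinearMap.equivOfDetNeZero (LinearMap.adjoint A) hA.det_adjoint_ne_zero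

@[simp]
theorem IsExpansiveDilation.adjointEquiv_apply {d : ℕ} {A : E d →ₗ[ℝ] E d}
    (hA : IsExpansiveDilation A) (x : E d) : hA.adjointEquiv x = LinearMap.adjoint A x := rfl

theorem map_equiv_volume {d : ℕ} (B : E d ≃ₗ[ℝ] E d) :
    Measure.map B (volume : Measure (E d)) =
      ENNReal.ofReal |(LinearMap.det (B : E d →ₗ[ℝ] E d))⁻¹| • volume :=
  Measure.map_linearMap_addHaar_eq_smul_addHaar volume (f := (B : E d →ₗ[ℝ] E d))
    (LinearEquiv.isUnit_det' B).ne_zero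

theorem measurable_equiv {d : ℕ} (B : E d ≃ₗ[ℝ] E d) : Measurable B :=
  B.toContinuousLinearEquiv.continuous.measurable

theorem memLp_comp_equiv {d : ℕ} (B : E d ≃ₗ[ℝ] E d) (f : L2 d) :
    MemLp (fun x => ((Real.sqrt |LinearMap.det (B : E d →ₗ[ℝ] E d)| : ℝ) : ℂ) * f (B x))
      2 volume := by
  refine MemLp.const_mul (f := fun x => f (B x)) ?_ _
  have h : MemLp f 2 (Measure.map B volume) := by
    rw [map_equiv_volume]
    exact (Lp.memLp f).smul_measure ENNReal.ofReal_ne_top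
  exact h.comp_of_map (measurable_equiv B).aemeasurable

theorem quasi_equiv {d : ℕ} (B : E d ≃ₗ[ℝ] E d) :
    Measure.QuasiMeasurePreserving B (volume : Measure (E d)) volume := by
  refine ⟨measurable_equiv B, ?_⟩
  rw [map_equiv_volume]
  exact Measure.smul_absolutelyContinuous

/-- `f ↦ |det B|^{1/2} f(B ·)` on `L²(ℝ^d)`, as a function. -/
def dilFun {d : ℕ} (B : E d ≃ₗ[ℝ] E d) (f : L2 d) : L2 d := (memLp_comp_equiv B f).toLp _

theorem dilFun_coe {d : ℕ} (B : E d ≃ₗ[ℝ] E d) (f : L2 d) :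
    dilFun B f =ᵐ[volume]
      fun x => ((Real.sqrt |LinearMap.det (B : E d →ₗ[ℝ] E d)| : ℝ) : ℂ) * f (B x) :=
  MemLp.coeFn_toLp _

theorem sqrt_abs_det_pos {d : ℕ} (B : E d ≃ₗ[ℝ] E d) :
    0 < Real.sqrt |LinearMap.det (B : E d →ₗ[ℝ] E d)| :=
  Real.sqrt_pos.2 (abs_pos.2 (LinearEquiv.isUnit_det' B).ne_zero)

theorem dilFun_symm {d : ℕ} (B : E d ≃ₗ[ℝ] E d) (f : L2 d) :
    dilFun B.symm (dilFun B f) = f := by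
  apply Lp.ext
  have h := (quasi_equiv B.symm).ae (dilFun_coe B f)
  filter_upwards [dilFun_coe B.symm (dilFun B f), h] with x h1 h2
  rw [h1, h2, LinearEquiv.apply_symm_apply, ← mul_assoc, ← Complex.ofReal_mul,
    ← Real.sqrt_mul (abs_nonneg _), ← abs_mul, LinearEquiv.det_symm_mul_det]
  simp

theorem norm_dilFun {d : ℕ} (B : E d ≃ₗ[ℝ] E d) (f : L2 d) : ‖dilFun B f‖ = ‖f‖ := by
  set D := LinearMap.det (B : E d →ₗ[ℝ] E d) with hD
  have hD0 : 0 < |D| := abs_pos.2 (LinearEquiv.isUnit_det' B).ne_zero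
  have h1 : eLpNorm (fun x => f (B x)) 2 volume
      = ENNReal.ofReal ((Real.sqrt |D|)⁻¹) * eLpNorm f 2 volume := by
    have := eLpNorm_map_measure (p := 2) (μ := (volume : Measure (E d))) (f := B) (g := f)
      (by rw [map_equiv_volume]; exact (Lp.aestronglyMeasurable f).smul_measure _)
      (measurable_equiv B).aemeasurable
    rw [map_equiv_volume, eLpNorm_smul_measure_of_ne_top (by norm_num)] at this
    rw [show (fun x => f (B x)) = f ∘ B from rfl, ← this, smul_eq_mul, ← hD]
    congr 1
    rw [ENNReal.ofReal_rpow_of_pos (by rw [abs_inv]; positivity), abs_inv, ← Real.sqrt_inv,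
      Real.sqrt_eq_rpow]
    norm_num
  rw [Lp.norm_def, Lp.norm_def, eLpNorm_congr_ae (dilFun_coe B f)]
  congr 1
  have h2 := eLpNorm_const_smul (((Real.sqrt |D| : ℝ) : ℂ)) (fun x => f (B x)) 2
    (volume : Measure (E d))
  simp only [Pi.smul_def, smul_eq_mul] at h2
  rw [h2, h1, ← mul_assoc, ← ofReal_norm, Complex.norm_real, Real.norm_eq_abs,
    abs_of_pos (Real.sqrt_pos.2 hD0), ← ENNReal.ofReal_mul (Real.sqrt_nonneg _),
    mul_inv_cancel₀ (Real.sqrt_pos.2 hD0).ne', ENNReal.ofReal_one, one_mul]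

/-- The unitary dilation operator `D_B f(x) = |det B|^{1/2} f(B x)` on `L²(ℝ^d)`. -/
def dil {d : ℕ} (B : E d ≃ₗ[ℝ] E d) : L2 d ≃ₗᵢ[ℂ] L2 d where
  toFun := dilFun B
  invFun := dilFun B.symm
  left_inv := dilFun_symm B
  right_inv := fun f => by simpa using dilFun_symm B.symm f
  map_add' := fun f g => by
    apply Lp.ext
    filter_upwards [dilFun_coe B (f + g), dilFun_coe B f, dilFun_coe B g,
      Lp.coeFn_add (dilFun B f) (dilFun B g), (quasi_equiv B).ae (Lp.coeFn_add f g)]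
      with x h1 h2 h3 h4 h5
    rw [h1, h4, h5, Pi.add_apply, Pi.add_apply, h2, h3, mul_add]
  map_smul' := fun c f => by
    apply Lp.ext
    filter_upwards [dilFun_coe B (c • f), dilFun_coe B f,
      Lp.coeFn_smul c (dilFun B f), (quasi_equiv B).ae (Lp.coeFn_smul c f)]
      with x h1 h2 h3 h4
    rw [h1, RingHom.id_apply, h3, h4, Pi.smul_apply, Pi.smul_apply, h2, smul_eq_mul,
      smul_eq_mul, mul_left_comm]
  norm_map' := norm_dilFun B

theorem dil_coe {d : ℕ} (B : E d ≃ₗ[ℝ] E d) (f : L2 d) :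
    dil B f =ᵐ[volume]
      fun x => ((Real.sqrt |LinearMap.det (B : E d →ₗ[ℝ] E d)| : ℝ) : ℂ) * f (B x) :=
  dilFun_coe B f

/-- The dilation operator `D_A` of an expansive dilation. Its integer powers `D_A ^ j`, `j : ℤ`,
are taken in the group of unitary operators. -/
def IsExpansiveDilation.D {d : ℕ} {A : E d →ₗ[ℝ] E d} (hA : IsExpansiveDilation A) :
    L2 d ≃ₗᵢ[ℂ] L2 d :=
  dil hA.equiv

/-- `V` is `A`-refinable: `V ⊆ D_A V`. -/
def IsRefinable {d : ℕ} {A : E d →ₗ[ℝ] E d} (hA : IsExpansiveDilation A)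
    (V : Submodule ℂ (L2 d)) : Prop :=
  (V : Set (L2 d)) ⊆ hA.D '' (V : Set (L2 d))

/-- `𝒢` generates `V`: the linear span of the integer shifts of the elements of `𝒢` is contained
and dense in the closed subspace `V`. -/
def Generates {d : ℕ} (𝒢 : Set (L2 d)) (V : Submodule ℂ (L2 d)) : Prop :=
  (Submodule.span ℂ {g : L2 d | ∃ φ ∈ 𝒢, ∃ k : Fin d → ℤ, g = shift k φ}).topologicalClosure = V

/-- The family `φ` in `V` is a tight frame generator of `V`:
`∑_α ∑_k |⟨f, φ^α(· - k)⟩|² = ‖f‖²` for all `f ∈ V`. -/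
structure IsTightFrameGenerator {d : ℕ} {ι : Type*} (V : Submodule ℂ (L2 d)) (φ : ι → L2 d) :
    Prop where
  mem : ∀ i, φ i ∈ V
  hasSum : ∀ f ∈ V,
    HasSum (fun p : ι × (Fin d → ℤ) => ‖inner ℂ (shift p.2 (φ p.1)) f‖ ^ 2) (‖f‖ ^ 2)

/-- `σ` is (a representative of) the spectral function of `V`: almost everywhere it is
`∑_α |φ̂^α(ξ)|²`, for a countable tight frame generator `(φ^α)` of `V`. -/
def IsSpectralFunction {d : ℕ} (V : Submodule ℂ (L2 d)) (σ : E d → ℝ≥0∞) : Prop :=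
  ∃ (ι : Type) (_ : Countable ι) (φ : ι → L2 d), IsTightFrameGenerator V φ ∧
    σ =ᵐ[volume] fun ξ => ∑' i, ‖(𝓕 (φ i) : L2 d) ξ‖ₑ ^ 2

/-- `H²_G = {f ∈ L²(ℝ^d) : Supp f̂ ⊆ G}`, the inclusion being understood up to null sets. -/
def H2 {d : ℕ} (G : Set (E d)) : Set (L2 d) :=
  {f | Function.support (𝓕 f : L2 d) ≤ᵐ[volume] G}

/-- `⋃_{j ∈ ℤ} A^{*j} S`. -/
def adjointOrbit {d : ℕ} {A : E d →ₗ[ℝ] E d} (hA : IsExpansiveDilation A) (S : Set (E d)) :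
    Set (E d) :=
  ⋃ j : ℤ, (hA.adjointEquiv ^ j) '' S

/-- `G` is the union of the sets `S φ`, `φ ∈ 𝒢`, in the sense of sets modulo null sets: it is the
least set, up to null sets, that contains each of them up to null sets. For a countable `𝒢` this
is the usual union, up to null sets; for an uncountable `𝒢` it is the only meaning of a union
of sets which are themselves defined up to null sets only. -/
def IsEssUnion {d : ℕ} {X : Type*} (𝒢 : Set X) (S : X → Set (E d)) (G : Set (E d)) : Prop :=
  (∀ φ ∈ 𝒢, S φ ≤ᵐ[volume] G) ∧
    ∀ F : Set (E d), (∀ φ ∈ 𝒢, S φ ≤ᵐ[volume] F) → G ≤ᵐ[volume] F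

end ShiftInv

end

/-! ### Translations, dilations and supports on the Fourier side. -/

noncomputable section

namespace ShiftInv

open scoped SchwartzMap InnerProductSpace

variable {d : ℕ}

/-! Each `H2 F` is closed and translation invariant, so it contains `V` as soon as it contains a
generating set. A tight frame generator is generating, since an element of `V` orthogonal to all its
shifts has norm zero. Hence `Supp σ` is the least `F` with `V ⊆ H2 F`, and it is equally the
essential union of the supports of `φ̂`, `φ ∈ 𝒢` (`IsSpectralFunction.support_ae_le_iff`,
`Generates.subset_H2_iff`). Transporting this by the powers of `A*` gives the formula for `G`.

On the Fourier side `D_A` moves supports by `A*`, so every `D_A^j V` lies in `H2 G`. For density,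
let `g ∈ H2 G` be orthogonal to all `D_A^j V`. By refinability, `f ∈ D_A^j V` lies in `D_A^n V` for
all `n ≥ j`, and that space is invariant under `A⁻ⁿ ℤ^d`. Since `A⁻ⁿ → 0`, these lattices have dense
union (`IsExpansiveDilation.dense_iUnion`). The pairing of `f(· - y)` with `g` is the Fourier
transform at `-y` of the product of `ĝ` with the conjugate of `f̂`; it is continuous in `y` and zero
on a dense set, so `ĝ = 0` a.e. on `Supp f̂` (`fourier_mul_eq_zero_of_dense`). Letting `f` and `j`
vary, `ĝ` vanishes on `G`, so `g = 0`.

A spectral function exists because an orthonormal basis of `L²`, cut off to the unit cell and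
projected to `V`, is a tight frame generator. -/

/-- Multiplication by an essentially bounded function, as an operator on `L²(ℝ^d)`. -/
def mulOp (m : Lp (α := E d) ℂ ∞ volume) : L2 d →L[ℂ] L2 d :=
  (ContinuousLinearMap.mul ℂ ℂ).holderL volume ∞ 2 2 m

theorem mulOp_coe (m : Lp (α := E d) ℂ ∞ volume) (f : L2 d) :
    mulOp m f =ᵐ[volume] fun x => m x * f x :=
  (ContinuousLinearMap.mul ℂ ℂ).coeFn_holder m f

/-- Translation `f ↦ f(· - y)` on `L²(ℝ^d)`. -/
def trans (y : E d) : L2 d →ₗᵢ[ℂ] L2 d :=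
  Lp.compMeasurePreservingₗᵢ ℂ (fun x : E d => x - y) (measurePreserving_sub_right volume y)

theorem shift_eq_trans (k : Fin d → ℤ) : shift k = trans (intVec k) := rfl

theorem trans_coe (y : E d) (f : L2 d) : trans y f =ᵐ[volume] fun x => f (x - y) :=
  Lp.coeFn_compMeasurePreserving f (measurePreserving_sub_right volume y)

/-- The character `ξ ↦ e^{-2πi⟨y, ξ⟩}`. -/
def modFun (y ξ : E d) : ℂ := (Real.fourierChar (-⟪y, ξ⟫_ℝ) : ℂ)

theorem continuous_modFun (y : E d) : Continuous (modFun y) := by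
  unfold modFun
  fun_prop

theorem memLp_modFun (y : E d) : MemLp (modFun y) ∞ (volume : Measure (E d)) :=
  memLp_top_of_bound (continuous_modFun y).aestronglyMeasurable 1
    (Filter.Eventually.of_forall fun _ => (Circle.norm_coe _).le)

theorem l2_induction_schwartz {p : L2 d → Prop} (hp : IsClosed {f | p f})
    (h : ∀ f : 𝓢(E d, ℂ), p (f.toLp 2 volume)) (f : L2 d) : p f :=
  DenseRange.induction_on (p := p)
    (SchwartzMap.denseRange_toLpCLM (F := ℂ) (μ := (volume : Measure (E d)))
      (p := 2) ENNReal.ofNat_ne_top) f hp h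

theorem continuous_fourier_l2 : Continuous (fun f : L2 d => (𝓕 f : L2 d)) :=
  (Lp.fourierTransformₗᵢ (E d) ℂ).continuous

/-- As an identity of continuous operators, rather than an a.e. one, this can be checked on the
dense Schwartz functions. -/
theorem fourier_trans_eq (y : E d) (f : L2 d) :
    (𝓕 (trans y f) : L2 d) = mulOp ((memLp_modFun y).toLp _) (𝓕 f : L2 d) := by
  refine l2_induction_schwartz (p := fun f => (𝓕 (trans y f) : L2 d)
    = mulOp ((memLp_modFun y).toLp _) (𝓕 f : L2 d)) ?_ ?_ f
  · exact isClosed_eq (continuous_fourier_l2.comp (trans y).continuous)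
      ((mulOp _).continuous.comp continuous_fourier_l2)
  intro f
  have h1 : trans y (f.toLp 2 volume) = (f.compSubConstCLM ℂ y).toLp 2 := by
    apply Lp.ext
    filter_upwards [trans_coe y (f.toLp 2 volume),
      (measurePreserving_sub_right volume y).quasiMeasurePreserving.ae (f.coeFn_toLp 2 volume),
      (f.compSubConstCLM ℂ y).coeFn_toLp 2 volume] with x h1 h2 h3
    rw [h1, h2, h3, SchwartzMap.compSubConstCLM_apply]
  rw [h1, SchwartzMap.toLp_fourier_eq, SchwartzMap.toLp_fourier_eq]
  apply Lp.ext
  filter_upwards [mulOp_coe ((memLp_modFun y).toLp _) ((𝓕 f).toLp 2 volume),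
    (memLp_modFun y).coeFn_toLp, (𝓕 f).coeFn_toLp 2 volume,
    (𝓕 (f.compSubConstCLM ℂ y)).coeFn_toLp 2 volume] with ξ h1 h2 h3 h4
  rw [h1, h2, h3, h4, SchwartzMap.fourier_coe, SchwartzMap.fourier_coe]
  have := congrFun (VectorFourier.fourierIntegral_comp_add_right Real.fourierChar
    (volume : Measure (E d)) (innerₗ (E d)) f (-y)) ξ
  simp only [← sub_eq_add_neg] at this
  refine Eq.trans this ?_
  simp only [modFun, Circle.smul_def, smul_eq_mul, map_neg, LinearMap.neg_apply]
  rfl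

theorem fourier_trans_coe (y : E d) (f : L2 d) :
    (𝓕 (trans y f) : L2 d) =ᵐ[volume] fun ξ => modFun y ξ * (𝓕 f : L2 d) ξ := by
  rw [fourier_trans_eq]
  filter_upwards [mulOp_coe ((memLp_modFun y).toLp _) (𝓕 f : L2 d),
    (memLp_modFun y).coeFn_toLp] with ξ h1 h2
  rw [h1, h2]

theorem schwartz_fourier_comp (B C : E d ≃ₗ[ℝ] E d)
    (hBC : ∀ x ξ, ⟪B x, C ξ⟫_ℝ = ⟪x, ξ⟫_ℝ) (f : 𝓢(E d, ℂ)) (ξ : E d) :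
    𝓕 (fun x => f (B x)) ξ
      = ((|(LinearMap.det (B : E d →ₗ[ℝ] E d))⁻¹| : ℝ) : ℂ) * 𝓕 (f : E d → ℂ) (C ξ) := by
  rw [Real.fourier_eq, Real.fourier_eq]
  have h1 := integral_map (μ := (volume : Measure (E d))) (measurable_equiv B).aemeasurable
    (f := fun x => Real.fourierChar (-⟪x, C ξ⟫_ℝ) • f x)
    (Continuous.aestronglyMeasurable (by have := f.continuous; fun_prop))
  simp only [hBC] at h1
  rw [← h1, map_equiv_volume, integral_smul_measure, ENNReal.toReal_ofReal (abs_nonneg _),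
    Complex.real_smul]

/-- Here `C` is the inverse adjoint of `B`. Only supports matter later, so the constant need only be
nonzero. -/
theorem exists_fourier_dil (B C : E d ≃ₗ[ℝ] E d) (hBC : ∀ x ξ, ⟪B x, C ξ⟫_ℝ = ⟪x, ξ⟫_ℝ) :
    ∃ c : ℂ, c ≠ 0 ∧ ∀ f : L2 d, (𝓕 (dil B f) : L2 d) = c • dil C (𝓕 f : L2 d) := by
  have hB := sqrt_abs_det_pos B
  have hC := sqrt_abs_det_pos C
  have hB0 : |(LinearMap.det (B : E d →ₗ[ℝ] E d))⁻¹| ≠ 0 :=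
    abs_ne_zero.2 (inv_ne_zero (LinearEquiv.isUnit_det' B).ne_zero)
  set b := Real.sqrt |LinearMap.det (B : E d →ₗ[ℝ] E d)| with hb
  set c := Real.sqrt |LinearMap.det (C : E d →ₗ[ℝ] E d)| with hc
  set e := |(LinearMap.det (B : E d →ₗ[ℝ] E d))⁻¹|
  -- `b` is the normalization of `dil B`, `e` the Jacobian of the substitution, and dividing by `c`
  -- cancels the normalization of `dil C`.
  refine ⟨((b * e / c : ℝ) : ℂ), Complex.ofReal_ne_zero.2 (by positivity), fun f => ?_⟩
  refine l2_induction_schwartz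
    (p := fun f => (𝓕 (dil B f) : L2 d) = ((b * e / c : ℝ) : ℂ) • dil C (𝓕 f : L2 d)) ?_ ?_ f
  · exact isClosed_eq (continuous_fourier_l2.comp (dil B).continuous)
      (Continuous.smul (f := fun _ => ((b * e / c : ℝ) : ℂ))
        (g := fun f : L2 d => dil C (𝓕 f : L2 d)) continuous_const
        ((dil C).continuous.comp continuous_fourier_l2))
  intro f
  let g : 𝓢(E d, ℂ) :=
    SchwartzMap.compCLMOfContinuousLinearEquiv ℂ B.toContinuousLinearEquiv f
  have h1 : dil B (f.toLp 2 volume) = (b : ℂ) • g.toLp 2 volume := by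
    apply Lp.ext
    filter_upwards [dil_coe B (f.toLp 2 volume), (quasi_equiv B).ae (f.coeFn_toLp 2 volume),
      g.coeFn_toLp 2 volume, Lp.coeFn_smul (b : ℂ) (g.toLp 2 volume)] with x h1 h2 h3 h4
    rw [h1, h2, h4, Pi.smul_apply, h3, smul_eq_mul]
    rfl
  have h0 : (𝓕 ((b : ℂ) • g.toLp 2 volume) : L2 d) = (b : ℂ) • (𝓕 (g.toLp 2 volume) : L2 d) :=
    (Lp.fourierTransformₗᵢ (E d) ℂ).map_smul _ _
  rw [h1, h0, SchwartzMap.toLp_fourier_eq, SchwartzMap.toLp_fourier_eq]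
  apply Lp.ext
  filter_upwards [Lp.coeFn_smul (b : ℂ) ((𝓕 g).toLp 2 volume), (𝓕 g).coeFn_toLp 2 volume,
    Lp.coeFn_smul ((b * e / c : ℝ) : ℂ) (dil C ((𝓕 f).toLp 2 volume)),
    dil_coe C ((𝓕 f).toLp 2 volume), (quasi_equiv C).ae ((𝓕 f).coeFn_toLp 2 volume)]
    with ξ h1 h2 h3 h4 h5
  rw [h1, h3, Pi.smul_apply, Pi.smul_apply, h2, h4, h5, SchwartzMap.fourier_coe,
    SchwartzMap.fourier_coe]
  have h6 := schwartz_fourier_comp B C hBC f ξ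
  have h7 : 𝓕 (g : E d → ℂ) ξ = 𝓕 (fun x => f (B x)) ξ := rfl
  have hc0 : (c : ℂ) ≠ 0 := Complex.ofReal_ne_zero.2 hC.ne'
  rw [h7, h6, ← hc, smul_eq_mul, smul_eq_mul, Complex.ofReal_div, Complex.ofReal_mul, ← mul_assoc,
    ← mul_assoc, div_mul_cancel₀ _ hc0]

/-- A test function is the Fourier transform of a Schwartz function, and the transform can be moved
across the integral onto `h`. -/
theorem ae_eq_zero_of_fourier_eq_zero {h : E d → ℂ} (hh : Integrable h)
    (h0 : ∀ y, 𝓕 h y = 0) : ∀ᵐ ξ, h ξ = 0 := by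
  refine ae_eq_zero_of_integral_contDiff_smul_eq_zero hh.locallyIntegrable fun g hg hgs => ?_
  have hgs' : HasCompactSupport (fun x => (g x : ℂ)) := hgs.comp_left Complex.ofReal_zero
  have hg' : ContDiff ℝ (⊤ : ℕ∞) (fun x => (g x : ℂ)) := Complex.ofRealCLM.contDiff.comp hg
  let s : 𝓢(E d, ℂ) := hgs'.toSchwartzMap hg'
  have h1 := VectorFourier.integral_fourierIntegral_smul_eq_flip (L := innerₗ (E d))
    (f := (𝓕⁻ s : 𝓢(E d, ℂ))) (g := h) (μ := volume) (ν := volume)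
    Real.continuous_fourierChar continuous_inner (𝓕⁻ s).integrable hh
  rw [flip_innerₗ] at h1
  have h2 : ∀ x, VectorFourier.fourierIntegral Real.fourierChar volume (innerₗ (E d)) h x = 0 :=
    h0
  have h3 : VectorFourier.fourierIntegral Real.fourierChar volume (innerₗ (E d))
      (𝓕⁻ s : 𝓢(E d, ℂ)) = s := by
    change 𝓕 ((𝓕⁻ s : 𝓢(E d, ℂ)) : E d → ℂ) = s
    rw [← SchwartzMap.fourier_coe, FourierTransform.fourier_fourierInv_eq]
  simp only [h2, smul_zero, integral_zero, h3] at h1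
  rw [← h1]
  refine integral_congr_ae (Filter.Eventually.of_forall fun x => ?_)
  simp only [Complex.real_smul, smul_eq_mul]
  rfl

/-- `H²_G` as a closed subspace. -/
def H2sub (G : Set (E d)) : Submodule ℂ (L2 d) where
  carrier := H2 G
  zero_mem' := by
    have h : (𝓕 (0 : L2 d) : L2 d) = 0 := (Lp.fourierTransformₗᵢ (E d) ℂ).map_zero
    change _ ≤ᵐ[volume] _
    rw [h]
    filter_upwards [Lp.coeFn_zero ℂ 2 (volume : Measure (E d))] with ξ h1 h2
    exact absurd h1 h2
  add_mem' := fun {f g} hf hg => by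
    have h : (𝓕 (f + g) : L2 d) = (𝓕 f : L2 d) + (𝓕 g : L2 d) :=
      (Lp.fourierTransformₗᵢ (E d) ℂ).map_add f g
    change _ ≤ᵐ[volume] _
    rw [h]
    filter_upwards [hf, hg, Lp.coeFn_add (𝓕 f : L2 d) (𝓕 g : L2 d)] with ξ h1 h2 h3 h4
    by_contra hG
    have h1' : (𝓕 f : L2 d) ξ = 0 := by_contra fun hc => hG (h1 hc)
    have h2' : (𝓕 g : L2 d) ξ = 0 := by_contra fun hc => hG (h2 hc)
    exact h4 (by rw [h3, Pi.add_apply, h1', h2', add_zero])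
  smul_mem' := fun c f hf => by
    have h : (𝓕 (c • f) : L2 d) = c • (𝓕 f : L2 d) :=
      (Lp.fourierTransformₗᵢ (E d) ℂ).map_smul c f
    change _ ≤ᵐ[volume] _
    rw [h]
    filter_upwards [hf, Lp.coeFn_smul c (𝓕 f : L2 d)] with ξ h1 h3 h4
    refine h1 fun hc => h4 ?_
    rw [h3, Pi.smul_apply, hc, smul_zero]

theorem mem_H2sub {G : Set (E d)} {f : L2 d} :
    f ∈ H2sub G ↔ Function.support (𝓕 f : L2 d) ≤ᵐ[volume] G := Iff.rfl

/-- An `L²`-convergent sequence of transforms has a subsequence converging a.e., which preserves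
vanishing off `G`. -/
theorem isClosed_H2 (G : Set (E d)) : IsClosed (H2 G) := by
  refine isClosed_of_closure_subset fun f hf => ?_
  obtain ⟨u, hu, hlim⟩ := mem_closure_iff_seq_limit.1 hf
  have h1 : Filter.Tendsto (fun n => (𝓕 (u n) : L2 d)) Filter.atTop (nhds (𝓕 f : L2 d)) :=
    (continuous_fourier_l2.tendsto f).comp hlim
  obtain ⟨ns, -, hns⟩ := (tendstoInMeasure_of_tendsto_Lp h1).exists_seq_tendsto_ae
  change _ ≤ᵐ[volume] _
  filter_upwards [hns, ae_all_iff.2 hu] with ξ h2 h3 h4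
  by_contra hG
  have h5 : ∀ n, (𝓕 (u n) : L2 d) ξ = 0 := fun n => by_contra fun hc => hG (h3 n hc)
  simp only [h5] at h2
  exact h4 (tendsto_nhds_unique h2 tendsto_const_nhds)

theorem trans_mem_H2 {G : Set (E d)} {f : L2 d} (hf : f ∈ H2 G) (y : E d) :
    trans y f ∈ H2 G := by
  change _ ≤ᵐ[volume] _
  filter_upwards [hf, fourier_trans_coe y f] with ξ h1 h2 h3
  exact h1 fun hc => h3 (by rw [h2, hc, mul_zero])

/-- The pairing of `f(· - y)` with `g` is a Fourier transform, by Plancherel. -/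
theorem inner_trans_eq_fourier (f g : L2 d) (y : E d) :
    inner ℂ (trans y f) g
      = 𝓕 (fun ξ => inner ℂ ((𝓕 f : L2 d) ξ) ((𝓕 g : L2 d) ξ)) (-y) := by
  rw [← Lp.inner_fourier_eq, L2.inner_def, Real.fourier_eq]
  refine integral_congr_ae ?_
  filter_upwards [fourier_trans_coe y f] with ξ h1
  rw [h1, ← smul_eq_mul, inner_smul_left, inner_neg_right, neg_neg, Circle.smul_def,
    smul_eq_mul, modFun, ← Circle.coe_inv_eq_conj, ← AddChar.map_neg_eq_inv, neg_neg,
    real_inner_comm]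

theorem fourier_mul_eq_zero_of_dense {f g : L2 d} {Y : Set (E d)} (hY : Dense Y)
    (h : ∀ y ∈ Y, inner ℂ (trans y f) g = 0) :
    ∀ᵐ ξ, (𝓕 f : L2 d) ξ ≠ 0 → (𝓕 g : L2 d) ξ = 0 := by
  have hint : Integrable (fun ξ => inner ℂ ((𝓕 f : L2 d) ξ) ((𝓕 g : L2 d) ξ)) :=
    L2.integrable_inner _ _
  have hcont : Continuous
      (𝓕 (fun ξ => inner ℂ ((𝓕 f : L2 d) ξ) ((𝓕 g : L2 d) ξ)) : E d → ℂ) :=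
    VectorFourier.fourierIntegral_continuous Real.continuous_fourierChar
      (L := innerₗ (E d)) continuous_inner hint
  have h0 : (fun y => 𝓕 (fun ξ => inner ℂ ((𝓕 f : L2 d) ξ) ((𝓕 g : L2 d) ξ)) (-y))
      = fun _ : E d => (0 : ℂ) :=
    (hcont.comp continuous_neg).ext_on hY continuous_const fun y hy => by
      rw [← h y hy, inner_trans_eq_fourier]
      rfl
  have h1 := ae_eq_zero_of_fourier_eq_zero hint fun y => by
    simpa using congrFun h0 (-y)
  filter_upwards [h1] with ξ h2 h3
  rw [RCLike.inner_apply] at h2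
  simpa [h3] using h2

end ShiftInv
end

/-! ### Existence of a spectral function. -/

noncomputable section

namespace ShiftInv

open scoped InnerProductSpace

/-- Orthonormal vectors are `√2` apart, so the balls of radius `1/2` around them are disjoint. -/
theorem Orthonormal.countable_of_separable {𝕜 H ι : Type*} [RCLike 𝕜]
    [NormedAddCommGroup H] [InnerProductSpace 𝕜 H] [TopologicalSpace.SeparableSpace H]
    {v : ι → H} (hv : Orthonormal 𝕜 v) : Countable ι := by
  refine Pairwise.countable_of_isOpen_disjoint (s := fun i => Metric.ball (v i) 2⁻¹)
    (fun i j hij => ?_) (fun _ => Metric.isOpen_ball)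
    (fun i => Metric.nonempty_ball.2 (by norm_num))
  refine Metric.ball_disjoint_ball ?_
  have h1 : ‖v i - v j‖ ^ 2 = 2 := by
    rw [@norm_sub_sq 𝕜, hv.1, hv.1, hv.2 hij]
    norm_num
  rw [dist_eq_norm]
  nlinarith [norm_nonneg (v i - v j)]

variable {d : ℕ}

/-- The unit cell of `ℤ^d` with corner `k`. -/
def cell (k : Fin d → ℤ) : Set (E d) := {x | ∀ i, ⌊x i⌋ = k i}

theorem measurableSet_cell (k : Fin d → ℤ) : MeasurableSet (cell k) := by
  have h : cell k = ⋂ i, (fun x : E d => ⌊x i⌋) ⁻¹' {k i} := by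
    ext x
    simp [cell]
  rw [h]
  refine MeasurableSet.iInter fun i => ?_
  have h2 : Measurable fun x : E d => x i := by fun_prop
  exact (Int.measurable_floor.comp h2) (measurableSet_singleton _)

theorem pairwise_disjoint_cell : Pairwise (Function.onFun Disjoint (cell (d := d))) := by
  intro k l hkl
  refine Set.disjoint_left.2 fun x hk hl => hkl (funext fun i => ?_)
  rw [← hk i, ← hl i]

theorem iUnion_cell : ⋃ k : Fin d → ℤ, cell k = (Set.univ : Set (E d)) :=
  Set.eq_univ_of_forall fun x => Set.mem_iUnion.2 ⟨fun i => ⌊x i⌋, fun _ => rfl⟩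

/-- Restriction of a function to the unit cell at the origin. -/
def restrictCell (f : L2 d) : L2 d :=
  ((Lp.memLp f).indicator (measurableSet_cell 0)).toLp _

theorem restrictCell_coe (f : L2 d) :
    restrictCell f =ᵐ[volume] (cell (0 : Fin d → ℤ)).indicator f :=
  MemLp.coeFn_toLp _

theorem inner_restrictCell (f g : L2 d) :
    inner ℂ (restrictCell f) g = inner ℂ f (restrictCell g) := by
  rw [L2.inner_def, L2.inner_def]
  refine integral_congr_ae ?_
  filter_upwards [restrictCell_coe f, restrictCell_coe g] with x h1 h2
  rw [h1, h2]
  by_cases hx : x ∈ cell (0 : Fin d → ℤ) <;> simp [hx]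

theorem trans_neg_trans (y : E d) (f : L2 d) : trans y (trans (-y) f) = f := by
  apply Lp.ext
  filter_upwards [trans_coe y (trans (-y) f),
    (measurePreserving_sub_right volume y).quasiMeasurePreserving.ae (trans_coe (-y) f)]
    with x h1 h2
  rw [h1, h2]
  congr 1
  abel

theorem inner_trans_left (y : E d) (f g : L2 d) :
    inner ℂ (trans y f) g = inner ℂ f (trans (-y) g) := by
  nth_rewrite 1 [← trans_neg_trans y g]
  exact (trans y).inner_map_map f _

theorem l2_norm_sq (f : L2 d) : ‖f‖ ^ 2 = ∫ x, ‖f x‖ ^ 2 := by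
  have h := inner_self_eq_norm_sq_to_K (𝕜 := ℂ) f
  rw [L2.inner_def] at h
  simp only [inner_self_eq_norm_sq_to_K] at h
  have h2 : ∫ x, ((‖f x‖ ^ 2 : ℝ) : ℂ) = ((‖f‖ ^ 2 : ℝ) : ℂ) := by
    push_cast
    exact h
  rw [integral_complex_ofReal] at h2
  exact_mod_cast h2.symm

theorem integrable_norm_sq (f : L2 d) : Integrable fun x => ‖f x‖ ^ 2 :=
  (Lp.memLp f).integrable_norm_pow (by norm_num)

theorem norm_restrictCell_trans_sq (k : Fin d → ℤ) (f : L2 d) :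
    ‖restrictCell (trans (-intVec k) f)‖ ^ 2 = ∫ x in cell k, ‖f x‖ ^ 2 := by
  rw [l2_norm_sq, ← integral_indicator (measurableSet_cell k),
    ← integral_add_right_eq_self ((cell k).indicator fun x => ‖f x‖ ^ 2) (intVec k)]
  refine integral_congr_ae ?_
  filter_upwards [restrictCell_coe (trans (-intVec k) f), trans_coe (-intVec k) f] with x h1 h2
  have h3 : x + intVec k ∈ cell k ↔ x ∈ cell (0 : Fin d → ℤ) := by
    refine forall_congr' fun i => ?_
    have : (x + intVec k) i = x i + (k i : ℤ) := rfl
    rw [this, Int.floor_add_intCast]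
    simp
  rw [h1]
  by_cases hx : x ∈ cell (0 : Fin d → ℤ)
  · rw [Set.indicator_of_mem hx, Set.indicator_of_mem (h3.2 hx), h2, sub_neg_eq_add]
  · rw [Set.indicator_of_notMem hx, Set.indicator_of_notMem (fun h => hx (h3.1 h))]
    simp

theorem hasSum_norm_restrictCell (f : L2 d) :
    HasSum (fun k : Fin d → ℤ => ‖restrictCell (trans (-intVec k) f)‖ ^ 2) (‖f‖ ^ 2) := by
  have h := hasSum_integral_iUnion (fun k : Fin d → ℤ => measurableSet_cell k)
    pairwise_disjoint_cell (integrable_norm_sq f).integrableOn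
  rw [iUnion_cell, Measure.restrict_univ, ← l2_norm_sq] at h
  simpa only [norm_restrictCell_trans_sq] using h

theorem hasSum_prod_of_nonneg {ι κ : Type*} {f : ι × κ → ℝ} (hf : 0 ≤ f) {g : κ → ℝ} {a : ℝ}
    (h1 : ∀ k, HasSum (fun i => f (i, k)) (g k)) (h2 : HasSum g a) : HasSum f a := by
  rw [← (Equiv.prodComm κ ι).hasSum_iff]
  have hs : Summable (f ∘ Equiv.prodComm κ ι) := by
    refine (summable_prod_of_nonneg (f := f ∘ Equiv.prodComm κ ι) fun p => hf _).2
      ⟨fun k => (h1 k).summable, ?_⟩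
    have : (fun k => ∑' i, (f ∘ Equiv.prodComm κ ι) (k, i)) = g :=
      funext fun k => (h1 k).tsum_eq
    rw [this]
    exact h2.summable
  have h3 := hs.hasSum
  rw [(h3.prod_fiberwise fun k => (h1 k)).unique h2] at h3
  exact h3

theorem HilbertBasis.hasSum_norm_inner_sq {ι H : Type*} [NormedAddCommGroup H]
    [InnerProductSpace ℂ H] (b : HilbertBasis ι ℂ H) (f : H) :
    HasSum (fun i => ‖inner ℂ (b i) f‖ ^ 2) (‖f‖ ^ 2) := by
  have h := b.hasSum_inner_mul_inner f f
  have h2 : HasSum (fun i => ((‖inner ℂ (b i) f‖ ^ 2 : ℝ) : ℂ)) ((‖f‖ ^ 2 : ℝ) : ℂ) := by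
    rw [inner_self_eq_norm_sq_to_K] at h
    push_cast
    convert! h using 1
    funext i
    rw [← inner_conj_symm f (b i), mul_comm, Complex.mul_conj, Complex.normSq_eq_norm_sq]
    push_cast
    rfl
  exact_mod_cast h2

/-- Moved onto `f`, the shift by `-k` stays in `V`, where the projection acts as the identity. -/
theorem inner_shift_starProjection {V : Submodule ℂ (L2 d)} [V.HasOrthogonalProjection]
    (hV : IsShiftInvariant V) {f : L2 d} (hf : f ∈ V) (k : Fin d → ℤ) (g : L2 d) :
    inner ℂ (shift k (V.starProjection g)) f = inner ℂ (shift k g) f := by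
  rw [shift_eq_trans, inner_trans_left, inner_trans_left]
  have h1 : trans (-intVec k) f ∈ V := by
    have h2 := hV.shift_mem f hf (-k)
    have h3 : intVec (-k) = -intVec k := by
      ext i
      simp [intVec]
    rwa [shift_eq_trans, h3] at h2
  rw [Submodule.inner_starProjection_left_eq_right, Submodule.starProjection_eq_self_iff.2 h1]

/-- The orthogonal projections of a tight frame of `L²(ℝ^d)` give one of `V`. -/
theorem exists_spectralFunction {V : Submodule ℂ (L2 d)} (hV : IsShiftInvariant V) :
    ∃ σ, IsSpectralFunction V σ := by
  obtain ⟨w, b, -⟩ := exists_hilbertBasis ℂ (L2 d)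
  have : Fact ((2 : ℝ≥0∞) ≠ ∞) := ⟨ENNReal.ofNat_ne_top⟩
  have hw : Countable w := Orthonormal.countable_of_separable b.orthonormal
  have : CompleteSpace V := hV.isClosed.completeSpace_coe
  refine ⟨_, w, hw, fun i => V.starProjection (restrictCell (b i)),
    ⟨fun i => V.starProjection_apply_mem _, fun f hf => ?_⟩, Filter.EventuallyEq.rfl⟩
  -- For fixed `k`, Parseval over the basis gives the energy of `f` on the cell at `k`; these
  -- energies add up to `‖f‖²`.
  refine hasSum_prod_of_nonneg (fun p => by positivity) (fun k => ?_)
    (hasSum_norm_restrictCell f)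
  have h : ∀ i, inner ℂ (shift k (V.starProjection (restrictCell (b i)))) f
      = inner ℂ (b i) (restrictCell (trans (-intVec k) f)) := fun i => by
    rw [inner_shift_starProjection hV hf, shift_eq_trans, inner_trans_left, inner_restrictCell]
  simp only [h]
  exact HilbertBasis.hasSum_norm_inner_sq b _

end ShiftInv
end

/-! ### Expansiveness: `A⁻ⁿ → 0` and density of the refined lattices. -/

noncomputable section

namespace ShiftInv

open Filter Topology

/-- In a complex Banach algebra, the powers of an element with spectrum in the open unit disc
tend to `0`. -/
theorem tendsto_pow_of_spectrum_lt_one {R : Type*} [NormedRing R] [NormedAlgebra ℂ R]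
    [CompleteSpace R] (a : R) (ha : ∀ z ∈ spectrum ℂ a, ‖z‖ < 1) :
    Tendsto (fun n : ℕ => a ^ n) atTop (𝓝 0) := by
  nontriviality R
  have h1 : spectralRadius ℂ a < (1 : NNReal) :=
    spectrum.spectralRadius_lt_of_forall_lt a fun z hz => by
      rw [← NNReal.coe_lt_coe]
      simpa using ha z hz
  obtain ⟨r, hr1, hr2⟩ := ENNReal.lt_iff_exists_nnreal_btwn.1 h1
  -- Gelfand's formula, with `r` strictly between the spectral radius and `1`.
  have h2 : ∀ᶠ n : ℕ in atTop, ‖a ^ n‖ ≤ (r : ℝ) ^ n := by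
    filter_upwards [(spectrum.pow_nnnorm_pow_one_div_tendsto_nhds_spectralRadius a).eventually
      (gt_mem_nhds hr1), eventually_gt_atTop 0] with n hn hn0
    have h3 := ENNReal.rpow_le_rpow hn.le (Nat.cast_nonneg n : (0 : ℝ) ≤ n)
    rw [← ENNReal.rpow_mul, one_div, inv_mul_cancel₀ (by positivity), ENNReal.rpow_one,
      ENNReal.rpow_natCast] at h3
    exact_mod_cast h3
  exact squeeze_zero_norm' h2 (tendsto_pow_atTop_nhds_zero_of_lt_one r.2 (by exact_mod_cast hr2))

/-- Applying `A` to `A⁻¹ v = z v` gives `v = z A v`, so `z ≠ 0` and `z⁻¹` is an eigenvalue of `A`.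
-/
theorem IsExpansiveDilation.norm_lt_one_of_hasEigenvalue_symm {d : ℕ} {A : E d →ₗ[ℝ] E d}
    (hA : IsExpansiveDilation A) {z : ℂ}
    (hz : Module.End.HasEigenvalue
      ((hA.equiv.symm : E d →ₗ[ℝ] E d).baseChange ℂ) z) : ‖z‖ < 1 := by
  obtain ⟨v, hv⟩ := hz.exists_hasEigenvector
  have h1 := hv.apply_eq_smul
  have h2 : (A.baseChange ℂ) (((hA.equiv.symm : E d →ₗ[ℝ] E d).baseChange ℂ) v) = v := by
    rw [← LinearMap.comp_apply, ← LinearMap.baseChange_comp]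
    have : A ∘ₗ (hA.equiv.symm : E d →ₗ[ℝ] E d) = LinearMap.id := by
      ext1 x
      exact hA.equiv.apply_symm_apply x
    rw [this, LinearMap.baseChange_id, LinearMap.id_apply]
  rw [h1, map_smul] at h2
  have hz0 : z ≠ 0 := by
    rintro rfl
    rw [zero_smul] at h2
    exact hv.2 h2.symm
  have h3 : Module.End.HasEigenvalue (A.baseChange ℂ) z⁻¹ := by
    refine Module.End.hasEigenvalue_of_hasEigenvector (x := v) ⟨?_, hv.2⟩
    rw [Module.End.mem_eigenspace_iff]
    nth_rewrite 2 [← h2]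
    rw [smul_smul, inv_mul_cancel₀ hz0, one_smul]
  have h4 := hA.one_lt_norm _ h3
  rw [norm_inv] at h4
  exact (one_lt_inv₀ (norm_pos_iff.2 hz0)).1 h4

attribute [local instance] Matrix.linftyOpNormedRing Matrix.linftyOpNormedAlgebra

/-- The powers of a linear map all of whose complex eigenvalues have modulus `< 1` tend to `0`. -/
theorem tendsto_pow_of_hasEigenvalue_lt_one {H ι : Type*} [NormedAddCommGroup H]
    [NormedSpace ℝ H] [FiniteDimensional ℝ H] [Fintype ι] [DecidableEq ι] (b : Module.Basis ι ℝ H)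
    (f : H →ₗ[ℝ] H)
    (hf : ∀ z : ℂ, Module.End.HasEigenvalue (f.baseChange ℂ) z → ‖z‖ < 1) :
    Tendsto (fun n : ℕ => (LinearMap.toContinuousLinearMap f) ^ n) atTop (𝓝 0) := by
  obtain ⟨M, hM⟩ : ∃ M, M = LinearMap.toMatrix b b f := ⟨_, rfl⟩
  have hM' : M.map (algebraMap ℝ ℂ)
      = LinearMap.toMatrix (Algebra.TensorProduct.basis ℂ b) (Algebra.TensorProduct.basis ℂ b)
        (f.baseChange ℂ) := by
    rw [LinearMap.toMatrix_baseChange, hM]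
  have h1 : Tendsto (fun n : ℕ => (M.map (algebraMap ℝ ℂ)) ^ n) atTop (𝓝 0) := by
    refine tendsto_pow_of_spectrum_lt_one _ fun z hz => hf z ?_
    rw [hM', LinearMap.spectrum_toMatrix] at hz
    exact Module.End.hasEigenvalue_iff_mem_spectrum.2 hz
  -- The real matrix powers are recovered entrywise as real parts of the complex ones.
  have h2 : Tendsto (fun n : ℕ => M ^ n) atTop (𝓝 0) := by
    refine tendsto_pi_nhds.2 fun i => tendsto_pi_nhds.2 fun j => ?_
    have h3 := tendsto_pi_nhds.1 (tendsto_pi_nhds.1 h1 i) j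
    have h4 := (Complex.continuous_re.tendsto _).comp h3
    refine Tendsto.congr (fun n => ?_) h4
    rw [Function.comp_apply, ← Matrix.map_pow]
    exact Complex.ofReal_re _
  let Φ : Matrix ι ι ℝ →ₗ[ℝ] (H →L[ℝ] H) :=
    (LinearMap.toContinuousLinearMap (𝕜 := ℝ) (E := H) (F' := H)).toLinearMap ∘ₗ
      (Matrix.toLin b b).toLinearMap
  have h3 := (Φ.continuous_of_finiteDimensional.tendsto 0).comp h2
  rw [map_zero] at h3
  refine h3.congr fun n => ?_
  change LinearMap.toContinuousLinearMap (Matrix.toLin b b (M ^ n)) = _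
  have h4 : Matrix.toLin b b (M ^ n) = f ^ n := by
    rw [hM, LinearMap.toMatrix_pow, Matrix.toLin_toMatrix]
  rw [h4]
  ext1 x
  rw [LinearMap.coe_toContinuousLinearMap']
  clear * -
  induction n with
  | zero => rfl
  | succ n ih =>
    rw [pow_succ', pow_succ', Module.End.mul_apply, ih]
    rfl

theorem IsExpansiveDilation.tendsto_symm_pow {d : ℕ} {A : E d →ₗ[ℝ] E d}
    (hA : IsExpansiveDilation A) :
    Tendsto (fun n : ℕ =>
      (LinearMap.toContinuousLinearMap (hA.equiv.symm : E d →ₗ[ℝ] E d)) ^ n) atTop (𝓝 0) :=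
  tendsto_pow_of_hasEigenvalue_lt_one (EuclideanSpace.basisFun (Fin d) ℝ).toBasis _
    fun _ hz => hA.norm_lt_one_of_hasEigenvalue_symm hz

/-- The lattice `ℤ^d` is a bounded distance away from every point. -/
theorem exists_norm_sub_intVec_le {d : ℕ} (x : E d) :
    ∃ k : Fin d → ℤ, ‖x - intVec k‖ ≤ Real.sqrt d := by
  refine ⟨fun i => ⌊x i⌋, ?_⟩
  rw [EuclideanSpace.norm_eq]
  refine Real.sqrt_le_sqrt ?_
  calc ∑ i, ‖(x - intVec fun i => ⌊x i⌋) i‖ ^ 2 ≤ ∑ _i : Fin d, (1 : ℝ) := by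
        refine Finset.sum_le_sum fun i _ => ?_
        have h : (x - intVec fun i => ⌊x i⌋) i = Int.fract (x i) := rfl
        rw [h, Real.norm_eq_abs, sq_abs]
        nlinarith [Int.fract_nonneg (x i), Int.fract_lt_one (x i)]
    _ = d := by simp

/-- Rounding `Aⁿ x` to a lattice point and applying `A⁻ⁿ` lands within `‖A⁻ⁿ‖ √d` of `x`. The bound
`m ≤ n` permits using only scales where a given `D_A^j V` is already contained in `D_A^n V`. -/
theorem IsExpansiveDilation.dense_iUnion {d : ℕ} {A : E d →ₗ[ℝ] E d}
    (hA : IsExpansiveDilation A) (m : ℕ) :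
    Dense {y : E d | ∃ n : ℕ, m ≤ n ∧ ∃ k : Fin d → ℤ, y = (hA.equiv.symm ^ n) (intVec k)} := by
  intro x
  choose k hk using fun n : ℕ => exists_norm_sub_intVec_le ((hA.equiv ^ n) x)
  let T := LinearMap.toContinuousLinearMap (hA.equiv.symm : E d →ₗ[ℝ] E d)
  have hT : ∀ (n : ℕ) (y : E d), (T ^ n) y = (hA.equiv.symm ^ n) y := fun n y => by
    induction n with
    | zero => rfl
    | succ n ih =>
      rw [pow_succ', pow_succ', LinearEquiv.mul_apply, ← ih]
      rfl
  have hinv : ∀ n : ℕ, (hA.equiv.symm ^ n) ((hA.equiv ^ n) x) = x := fun n => by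
    rw [← LinearEquiv.mul_apply]
    have : hA.equiv.symm = (hA.equiv)⁻¹ := rfl
    rw [this, inv_pow, inv_mul_cancel]
    rfl
  have h1 : Tendsto (fun n : ℕ => (hA.equiv.symm ^ n) (intVec (k n))) atTop (𝓝 x) := by
    rw [tendsto_iff_norm_sub_tendsto_zero]
    have h2 := (hA.tendsto_symm_pow.norm).mul_const (Real.sqrt d)
    rw [norm_zero, zero_mul] at h2
    refine squeeze_zero (fun _ => norm_nonneg _) (fun n => ?_) h2
    have h3 : (hA.equiv.symm ^ n) (intVec (k n)) - x
        = (T ^ n) (intVec (k n) - (hA.equiv ^ n) x) := by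
      rw [hT, map_sub, hinv]
    rw [h3]
    refine ((T ^ n).le_opNorm _).trans ?_
    rw [norm_sub_rev]
    exact mul_le_mul_of_nonneg_left (hk n) (norm_nonneg _)
  refine mem_closure_of_tendsto h1 ?_
  filter_upwards [eventually_ge_atTop m] with n hn
  exact ⟨n, hn, k n, rfl⟩

end ShiftInv
end

/-! ### Orbits of supports, generators, and density of the dilates. -/

noncomputable section

namespace ShiftInv

open scoped InnerProductSpace

variable {d : ℕ}

theorem iUnion_ae_le {ι : Type*} [Countable ι] {S : ι → Set (E d)} {T : Set (E d)}
    (h : ∀ i, S i ≤ᵐ[volume] T) : (⋃ i, S i : Set (E d)) ≤ᵐ[volume] T := by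
  filter_upwards [ae_all_iff.2 h] with x hx hxS
  obtain ⟨i, hi⟩ := Set.mem_iUnion.1 hxS
  exact hx i hi

theorem image_ae_le (B : E d ≃ₗ[ℝ] E d) {S T : Set (E d)} (h : S ≤ᵐ[volume] T) :
    (B '' S : Set (E d)) ≤ᵐ[volume] (B '' T : Set (E d)) := by
  filter_upwards [(quasi_equiv B.symm).ae h] with x hx hxS
  obtain ⟨s, hs, rfl⟩ := hxS
  rw [B.symm_apply_apply] at hx
  exact ⟨s, hx hs, rfl⟩

theorem zpow_image_zpow_image (B : E d ≃ₗ[ℝ] E d) (i j : ℤ) (S : Set (E d)) :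
    (B ^ i) '' ((B ^ j) '' S) = (B ^ (i + j)) '' S := by
  rw [Set.image_image, zpow_add]
  rfl

theorem image_zpow_ae_le_iff (B : E d ≃ₗ[ℝ] E d) (j : ℤ) {S T : Set (E d)} :
    ((B ^ j) '' S : Set (E d)) ≤ᵐ[volume] T ↔ S ≤ᵐ[volume] ((B ^ (-j)) '' T : Set (E d)) := by
  have h0 : ∀ U : Set (E d), (B ^ (0 : ℤ)) '' U = U := fun U => Set.image_id U
  constructor
  · intro h
    have := image_ae_le (B ^ (-j)) h
    rwa [zpow_image_zpow_image, neg_add_cancel, h0] at this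
  · intro h
    have := image_ae_le (B ^ j) h
    rwa [zpow_image_zpow_image, add_neg_cancel, h0] at this

section Dilation

variable {A : E d →ₗ[ℝ] E d} (hA : IsExpansiveDilation A)

/-- This turns a question about an orbit into countably many about `S` alone, to which the
minimality of `Supp σ` applies. -/
theorem adjointOrbit_ae_le_iff {S T : Set (E d)} :
    adjointOrbit hA S ≤ᵐ[volume] T ↔ ∀ j : ℤ, S ≤ᵐ[volume] ((hA.adjointEquiv ^ j) '' T : Set _) := by
  constructor
  · intro h j
    rw [← neg_neg j, ← image_zpow_ae_le_iff]
    refine Filter.EventuallyLE.trans (LE.le.eventuallyLE ?_) h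
    exact Set.subset_iUnion (fun j : ℤ => (hA.adjointEquiv ^ j) '' S) (-j)
  · intro h
    refine iUnion_ae_le fun j => ?_
    rw [image_zpow_ae_le_iff]
    exact h (-j)

theorem adjointOrbit_mono_ae {S T : Set (E d)} (h : S ≤ᵐ[volume] T) :
    adjointOrbit hA S ≤ᵐ[volume] adjointOrbit hA T :=
  iUnion_ae_le fun j => (image_ae_le _ h).trans
    (LE.le.eventuallyLE
      (Set.subset_iUnion (fun j : ℤ => (hA.adjointEquiv ^ j) '' T) j))

theorem support_fourier_D (f : L2 d) :
    Function.support (𝓕 (hA.D f) : L2 d) =ᵐ[volume]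
      (hA.adjointEquiv '' Function.support (𝓕 f : L2 d) : Set (E d)) := by
  obtain ⟨c, hc, h⟩ := exists_fourier_dil hA.equiv hA.adjointEquiv.symm fun x ξ => by
    rw [hA.equiv_apply, ← LinearMap.adjoint_inner_right, ← hA.adjointEquiv_apply,
      LinearEquiv.apply_symm_apply]
  have h1 : hA.D f = dil hA.equiv f := rfl
  rw [h1, h f]
  have h2 : (Real.sqrt |LinearMap.det (hA.adjointEquiv.symm : E d →ₗ[ℝ] E d)| : ℂ) ≠ 0 :=
    Complex.ofReal_ne_zero.2 (sqrt_abs_det_pos hA.adjointEquiv.symm).ne'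
  filter_upwards [Lp.coeFn_smul c (dil hA.adjointEquiv.symm (𝓕 f : L2 d)),
    dil_coe hA.adjointEquiv.symm (𝓕 f : L2 d)] with ξ h3 h4
  refine propext ?_
  change (c • dil hA.adjointEquiv.symm (𝓕 f : L2 d) : L2 d) ξ ≠ 0 ↔
    ξ ∈ hA.adjointEquiv '' Function.support (𝓕 f : L2 d)
  rw [h3, Pi.smul_apply, h4, LinearEquiv.image_eq_preimage_symm, Set.mem_preimage,
    Function.mem_support, smul_eq_mul, mul_ne_zero_iff, mul_ne_zero_iff]
  exact ⟨fun h => h.2.2, fun h => ⟨hc, h2, h⟩⟩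

theorem support_fourier_D_zpow (j : ℤ) (f : L2 d) :
    Function.support (𝓕 ((hA.D ^ j) f) : L2 d) =ᵐ[volume]
      ((hA.adjointEquiv ^ j) '' Function.support (𝓕 f : L2 d) : Set (E d)) := by
  have key : ∀ (j : ℤ), Function.support (𝓕 ((hA.D ^ (1 + j)) f) : L2 d) =ᵐ[volume]
      (hA.adjointEquiv '' Function.support (𝓕 ((hA.D ^ j) f) : L2 d) : Set (E d)) := fun j => by
    rw [zpow_one_add]
    exact support_fourier_D hA _
  have himg : ∀ {B : E d ≃ₗ[ℝ] E d} {S T : Set (E d)}, S =ᵐ[volume] T →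
      (B '' S : Set (E d)) =ᵐ[volume] (B '' T : Set (E d)) := fun {B} {S T} h =>
    (image_ae_le B h.le).antisymm (image_ae_le B h.symm.le)
  induction j using Int.induction_on with
  | zero => exact (Set.image_id _).symm.eventuallyEq
  | succ n ih =>
    rw [add_comm]
    refine (key n).trans ((himg ih).trans ?_)
    rw [zpow_add, zpow_one, Set.image_image]
    exact Filter.EventuallyEq.rfl
  | pred n ih =>
    -- Downwards, the one-step relation from `-n - 1` to `-n` is inverted by applying `A*⁻¹`.
    have h1 := (key (-n - 1)).symm
    rw [show (1 : ℤ) + (-n - 1) = -n by ring] at h1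
    have h2 := himg (B := hA.adjointEquiv ^ (-1 : ℤ)) (h1.trans ih)
    rw [zpow_image_zpow_image, show (-1 : ℤ) + -n = -n - 1 by ring, Set.image_image] at h2
    refine Filter.EventuallyEq.trans ?_ h2
    refine Filter.Eventually.of_forall fun ξ => ?_
    have h3 : ∀ x, (hA.adjointEquiv ^ (-1 : ℤ)) (hA.adjointEquiv x) = x := fun x =>
      hA.adjointEquiv.symm_apply_apply x
    simp only [h3, Set.image_id']

theorem D_trans (y : E d) (f : L2 d) :
    hA.D (trans y f) = trans (hA.equiv.symm y) (hA.D f) := by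
  apply Lp.ext
  filter_upwards [dil_coe hA.equiv (trans y f), trans_coe (hA.equiv.symm y) (hA.D f),
    (quasi_equiv hA.equiv).ae (trans_coe y f),
    (measurePreserving_sub_right volume (hA.equiv.symm y)).quasiMeasurePreserving.ae
      (dil_coe hA.equiv f)] with x h1 h2 h3 h4
  change (dil hA.equiv (trans y f)) x = (trans (hA.equiv.symm y) (dil hA.equiv f)) x
  refine h1.trans ((Eq.trans ?_ h4.symm).trans h2.symm)
  rw [h3, map_sub, LinearEquiv.apply_symm_apply]

/-- With `y` in `ℤ^d`, this makes `D_A^n V` invariant under `A⁻ⁿ ℤ^d`. -/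
theorem D_pow_trans (n : ℕ) (y : E d) (f : L2 d) :
    (hA.D ^ n) (trans y f) = trans ((hA.equiv.symm ^ n) y) ((hA.D ^ n) f) := by
  induction n with
  | zero => rfl
  | succ n ih =>
    rw [pow_succ', pow_succ']
    change hA.D ((hA.D ^ n) (trans y f)) = _
    rw [ih, D_trans]
    rfl

theorem IsRefinable.monotone {V : Submodule ℂ (L2 d)} (hVA : IsRefinable hA V) :
    Monotone fun j : ℤ => (hA.D ^ j) '' (V : Set (L2 d)) := by
  refine monotone_int_of_le_succ fun j => ?_
  rintro _ ⟨f, hf, rfl⟩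
  obtain ⟨g, hg, rfl⟩ := hVA hf
  refine ⟨g, hg, ?_⟩
  rw [zpow_add_one]
  rfl

end Dilation

theorem Generates.mem {𝒢 : Set (L2 d)} {V : Submodule ℂ (L2 d)} (h : Generates 𝒢 V) {φ : L2 d}
    (hφ : φ ∈ 𝒢) : φ ∈ V := by
  have h1 : φ ∈ Submodule.span ℂ {g : L2 d | ∃ φ ∈ 𝒢, ∃ k : Fin d → ℤ, g = shift k φ} := by
    refine Submodule.subset_span ⟨φ, hφ, 0, ?_⟩
    rw [shift_eq_trans]
    apply Lp.ext
    filter_upwards [trans_coe (intVec (0 : Fin d → ℤ)) φ] with x hx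
    rw [hx]
    congr 1
    ext i
    simp [intVec]
  rw [← h]
  exact Submodule.le_topologicalClosure _ h1

theorem Generates.subset_H2_iff {𝒢 : Set (L2 d)} {V : Submodule ℂ (L2 d)} (h : Generates 𝒢 V)
    (F : Set (E d)) :
    (V : Set (L2 d)) ⊆ H2 F ↔ ∀ φ ∈ 𝒢, Function.support (𝓕 φ : L2 d) ≤ᵐ[volume] F := by
  refine ⟨fun hV φ hφ => hV (h.mem hφ), fun hF => ?_⟩
  have h1 : (Submodule.span ℂ
      {g : L2 d | ∃ φ ∈ 𝒢, ∃ k : Fin d → ℤ, g = shift k φ}).topologicalClosure ≤ H2sub F := by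
    refine Submodule.topologicalClosure_minimal _ (Submodule.span_le.2 ?_) (isClosed_H2 F)
    rintro _ ⟨φ, hφ, k, rfl⟩
    exact trans_mem_H2 (hF φ hφ) _
  rw [h] at h1
  exact h1

/-- The shifts of a tight frame generator span a dense subspace. -/
theorem IsTightFrameGenerator.generates {ι : Type*} {V : Submodule ℂ (L2 d)} {φ : ι → L2 d}
    (hV : IsShiftInvariant V) (h : IsTightFrameGenerator V φ) : Generates (Set.range φ) V := by
  set U := (Submodule.span ℂ
    {g : L2 d | ∃ ψ ∈ Set.range φ, ∃ k : Fin d → ℤ, g = shift k ψ}).topologicalClosure with hU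
  have hUV : U ≤ V := by
    refine Submodule.topologicalClosure_minimal _ (Submodule.span_le.2 ?_) hV.isClosed
    rintro _ ⟨_, ⟨i, rfl⟩, k, rfl⟩
    exact hV.shift_mem _ (h.mem i) k
  have hmem : ∀ i k, shift k (φ i) ∈ U := fun i k =>
    Submodule.le_topologicalClosure _ (Submodule.subset_span ⟨φ i, ⟨i, rfl⟩, k, rfl⟩)
  have : CompleteSpace U := (Submodule.isClosed_topologicalClosure _).completeSpace_coe
  refine le_antisymm hUV fun f hf => ?_
  -- The component of `f` orthogonal to `U` lies in `V` and has zero frame coefficients, so the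
  -- frame identity makes it zero.
  have h1 := h.hasSum (f - U.starProjection f)
    (V.sub_mem hf (hUV (U.starProjection_apply_mem f)))
  have h2 : ∀ p : ι × (Fin d → ℤ),
      ‖inner ℂ (shift p.2 (φ p.1)) (f - U.starProjection f)‖ ^ 2 = 0 := fun p => by
    rw [(U.sub_starProjection_mem_orthogonal f) _ (hmem p.1 p.2)]
    simp
  simp only [h2] at h1
  have h3 := h1.unique hasSum_zero
  rw [sq_eq_zero_iff, norm_eq_zero, sub_eq_zero] at h3
  rw [h3]
  exact U.starProjection_apply_mem f

/-- A sum of nonnegative terms vanishes exactly where all terms do, and the frame is countable, so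
null sets can be collected. The right side no longer mentions the frame: `Supp σ` depends on `V`
only. -/
theorem IsSpectralFunction.support_ae_le_iff {V : Submodule ℂ (L2 d)} {σ : E d → ℝ≥0∞}
    (hV : IsShiftInvariant V) (hσ : IsSpectralFunction V σ) (F : Set (E d)) :
    Function.support σ ≤ᵐ[volume] F ↔ (V : Set (L2 d)) ⊆ H2 F := by
  obtain ⟨ι, hι, φ, hφ, hσφ⟩ := hσ
  rw [(hφ.generates hV).subset_H2_iff, Set.forall_mem_range]
  constructor
  · intro h i
    filter_upwards [h, hσφ] with ξ h1 h2 h3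
    refine h1 fun h4 => h3 ?_
    rw [h4, eq_comm, ENNReal.tsum_eq_zero] at h2
    simpa using h2 i
  · intro h
    filter_upwards [ae_all_iff.2 h, hσφ] with ξ h1 h2 h3
    by_contra hF
    refine h3 ?_
    rw [h2, ENNReal.tsum_eq_zero]
    intro i
    have : (𝓕 (φ i) : L2 d) ξ = 0 := by_contra fun hc => hF (h1 i hc)
    simp [this]

theorem IsSpectralFunction.isEssUnion {A : E d →ₗ[ℝ] E d} (hA : IsExpansiveDilation A)
    {V : Submodule ℂ (L2 d)} (hV : IsShiftInvariant V) {𝒢 : Set (L2 d)} (h𝒢 : Generates 𝒢 V)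
    {σ : E d → ℝ≥0∞} (hσ : IsSpectralFunction V σ) :
    IsEssUnion 𝒢 (fun φ => adjointOrbit hA (Function.support (𝓕 φ : L2 d)))
      (adjointOrbit hA (Function.support σ)) := by
  constructor
  · intro φ hφ
    exact adjointOrbit_mono_ae hA
      ((hσ.support_ae_le_iff hV _).1 Filter.EventuallyLE.rfl (h𝒢.mem hφ))
  · intro F hF
    rw [adjointOrbit_ae_le_iff]
    intro j
    rw [hσ.support_ae_le_iff hV, h𝒢.subset_H2_iff]
    exact fun φ hφ => (adjointOrbit_ae_le_iff hA).1 (hF φ hφ) j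

theorem isEssUnion_biUnion {X : Type*} {𝒢 : Set X} (h𝒢 : 𝒢.Countable) (S : X → Set (E d)) :
    IsEssUnion 𝒢 S (⋃ φ ∈ 𝒢, S φ) := by
  refine ⟨fun φ hφ => LE.le.eventuallyLE (Set.subset_biUnion_of_mem hφ),
    fun F hF => ?_⟩
  have := h𝒢.to_subtype
  rw [Set.biUnion_eq_iUnion]
  exact iUnion_ae_le fun φ => hF φ φ.2

theorem IsEssUnion.ae_eq {X : Type*} {𝒢 : Set X} {S : X → Set (E d)} {G G' : Set (E d)}
    (h : IsEssUnion 𝒢 S G) (h' : IsEssUnion 𝒢 S G') : G =ᵐ[volume] G' :=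
  (h.2 _ h'.1).antisymm (h'.2 _ h.1)

theorem eq_zero_of_fourier_ae_eq_zero {g : L2 d} (h : ∀ᵐ ξ, (𝓕 g : L2 d) ξ = 0) : g = 0 := by
  have h1 : (𝓕 g : L2 d) = 0 := by
    apply Lp.ext
    filter_upwards [h, Lp.coeFn_zero ℂ 2 (volume : Measure (E d))] with ξ h1 h2
    rw [h1, h2]
    rfl
  rw [← norm_eq_zero, ← Lp.norm_fourier_eq, h1, norm_zero]

/-- A function of `H²_G` orthogonal to all dilates of `V` vanishes. -/
theorem eq_zero_of_orthogonal {A : E d →ₗ[ℝ] E d} (hA : IsExpansiveDilation A)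
    {V : Submodule ℂ (L2 d)} (hV : IsShiftInvariant V) (hVA : IsRefinable hA V)
    {σ : E d → ℝ≥0∞} (hσ : IsSpectralFunction V σ) {g : L2 d}
    (hg : g ∈ H2 (adjointOrbit hA (Function.support σ)))
    (horth : ∀ (j : ℤ), ∀ f ∈ V, inner ℂ ((hA.D ^ j) f) g = 0) : g = 0 := by
  have h1 : ∀ (j : ℤ), ∀ f ∈ V, Function.support (𝓕 ((hA.D ^ j) f) : L2 d)
      ≤ᵐ[volume] {ξ | (𝓕 g : L2 d) ξ = 0} := fun j f hf => by
    refine fourier_mul_eq_zero_of_dense (hA.dense_iUnion j.toNat) ?_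
    rintro _ ⟨n, hn, k, rfl⟩
    -- Refinability rewrites `D_A^j f` as `D_A^n v` with `v ∈ V`; its translate by `A⁻ⁿ k` is then
    -- `D_A^n` of a shift of `v`, hence orthogonal to `g`.
    obtain ⟨v, hv, hvf⟩ := hVA.monotone hA
      (show j ≤ (n : ℤ) from j.self_le_toNat.trans (by exact_mod_cast hn)) ⟨f, hf, rfl⟩
    simp only [zpow_natCast] at hvf
    rw [← hvf, ← D_pow_trans, ← zpow_natCast]
    exact horth n _ (hV.shift_mem v hv k)
  have h2 : adjointOrbit hA (Function.support σ) ≤ᵐ[volume] {ξ | (𝓕 g : L2 d) ξ = 0} := by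
    rw [adjointOrbit_ae_le_iff]
    intro j
    rw [hσ.support_ae_le_iff hV]
    intro f hf
    have h3 := (support_fourier_D_zpow hA (-j) f).symm.le.trans (h1 (-j) f hf)
    rwa [image_zpow_ae_le_iff, neg_neg] at h3
  refine eq_zero_of_fourier_ae_eq_zero ?_
  filter_upwards [mem_H2sub.1 hg, h2] with ξ h3 h4
  by_contra h5
  exact h5 (h4 (h3 h5))

theorem closure_iUnion_D_zpow {A : E d →ₗ[ℝ] E d} (hA : IsExpansiveDilation A)
    {V : Submodule ℂ (L2 d)} (hV : IsShiftInvariant V) (hVA : IsRefinable hA V)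
    {σ : E d → ℝ≥0∞} (hσ : IsSpectralFunction V σ) :
    closure (⋃ j : ℤ, (hA.D ^ j) '' (V : Set (L2 d)))
      = H2 (adjointOrbit hA (Function.support σ)) := by
  have hsub : closure (⋃ j : ℤ, (hA.D ^ j) '' (V : Set (L2 d)))
      ⊆ H2 (adjointOrbit hA (Function.support σ)) := by
    refine closure_minimal (Set.iUnion_subset fun j => ?_) (isClosed_H2 _)
    rintro _ ⟨f, hf, rfl⟩
    have h1 := (hσ.support_ae_le_iff hV _).1 Filter.EventuallyLE.rfl hf
    exact (support_fourier_D_zpow hA j f).le.trans ((image_ae_le _ h1).trans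
      (LE.le.eventuallyLE
        (Set.subset_iUnion (fun j : ℤ => (hA.adjointEquiv ^ j) '' Function.support σ) j)))
  refine hsub.antisymm fun g hg => ?_
  let M : ℤ → Submodule ℂ (L2 d) := fun j =>
    V.map ((hA.D ^ j).toLinearEquiv : L2 d →ₗ[ℂ] L2 d)
  have hM : ∀ j, (M j : Set (L2 d)) = (hA.D ^ j) '' (V : Set (L2 d)) := fun j => rfl
  have hmono : Monotone M := fun i j hij => hVA.monotone hA hij
  -- The dilates are nested, so their union is already a subspace and its closure carries an
  -- orthogonal projection.
  have hcoe : ((⨆ j, M j : Submodule ℂ (L2 d)) : Set (L2 d))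
      = ⋃ j : ℤ, (hA.D ^ j) '' (V : Set (L2 d)) :=
    Submodule.coe_iSup_of_directed M hmono.directed_le
  rw [← hcoe, ← Submodule.topologicalClosure_coe] at hsub ⊢
  set W := (⨆ j, M j).topologicalClosure with hW
  have : CompleteSpace W := (Submodule.isClosed_topologicalClosure _).completeSpace_coe
  have h0 : g - W.starProjection g = 0 := by
    refine eq_zero_of_orthogonal hA hV hVA hσ
      ((H2sub _).sub_mem hg (hsub (W.starProjection_apply_mem g))) fun j f hf => ?_
    refine (W.sub_starProjection_mem_orthogonal g) _ ?_
    exact Submodule.le_topologicalClosure _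
      (Submodule.mem_iSup_of_mem j (show _ ∈ M j from ⟨f, hf, rfl⟩))
  rw [sub_eq_zero.1 h0]
  exact W.starProjection_apply_mem g

end ShiftInv
end

theorem mainTheorem3 (d : ℕ) (A : ShiftInv.E d →ₗ[ℝ] ShiftInv.E d)
    (hA : ShiftInv.IsExpansiveDilation A) (V : Submodule ℂ (ShiftInv.L2 d))
    (hV : ShiftInv.IsShiftInvariant V) (hVA : ShiftInv.IsRefinable hA V)
    (𝒢 : Set (ShiftInv.L2 d)) (h𝒢 : ShiftInv.Generates 𝒢 V) :
    (∃ σ, ShiftInv.IsSpectralFunction V σ) ∧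
    ∀ σ : ShiftInv.E d → ℝ≥0∞, ShiftInv.IsSpectralFunction V σ →
      ∀ G : Set (ShiftInv.E d), G = ShiftInv.adjointOrbit hA (Function.support σ) →
        closure (⋃ j : ℤ, (hA.D ^ j) '' (V : Set (ShiftInv.L2 d))) = ShiftInv.H2 G ∧
        (𝒢.Countable →
          G =ᵐ[volume] ⋃ φ ∈ 𝒢, ShiftInv.adjointOrbit hA
            (Function.support (𝓕 φ : ShiftInv.L2 d))) ∧
        ShiftInv.IsEssUnion 𝒢
          (fun φ => ShiftInv.adjointOrbit hA (Function.support (𝓕 φ : ShiftInv.L2 d))) G := by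
  refine ⟨ShiftInv.exists_spectralFunction hV, ?_⟩
  rintro σ hσ _ rfl
  have h := hσ.isEssUnion hA hV h𝒢
  exact ⟨ShiftInv.closure_iUnion_D_zpow hA hV hVA hσ,
    fun hc => h.ae_eq (ShiftInv.isEssUnion_biUnion hc _), h⟩
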